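/- Let $d\ge 3$, let $a>1$ be a real number with $\bar a:=2a^{d-1}-a^d-1>0$, and let $0<\varepsilon<\bar a$. Put $C=2\lceil 4^{a+2}\rceil$. For an irrational number $\beta$ let $(q_n)_{n\ge 0}$ denote the sequence of denominators of the convergents of its continued fraction ($q_0=1$). Let $\alpha_1,\dots,\alpha_d$ be irrational numbers whose denominators $q^{(j)}_n$ ($1\le j\le d$) satisfy $$4\,(q^{(j)}_n)^a\le q^{(j+1)}_n\le C\,(q^{(j)}_n)^a\qquad\text{for all }1\le j\le d,\ n\ge 1,$$ where $q^{(d+1)}_n:=q^{(1)}_{n+1}$. Write $\mathbb T=\mathbb R/\mathbb Z$ and define the Cantor-type sets $$F^{(j)}=\bigcap_{n=1}^{\infty}\ \bigcup_{l=0}^{q^{(j)}_n-1}\left(\frac{l}{q^{(j)}_n}+\left[-\frac{1}{\sqrt{q^{(j)}_nq^{(j)}_{n+1}}},\frac{1}{\sqrt{q^{(j)}_nq^{(j)}_{n+1}}}\right]\right)\subset\mathbb T .$$ Let $\varphi:\mathbb T^d\to\mathbb R$, $\varphi(x_1,\dots,x_d)=\varphi_1(x_1)+\dots+\varphi_d(x_d)$,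 where $$\varphi_j(x)=\sum_{n=1}^\infty\bigl(f_{n,j}(x+\alpha_j)-f_{n,j}(x)\bigr),\qquad f_{n,j}(x)=\frac{q^{(j)}_{n+1}}{(q^{(j)}_n)^{1+\bar a-\varepsilon}}\bigl(1-\cos 2\pi q^{(j)}_nx\bigr).$$ Let $T:\mathbb T^d\to\mathbb T^d$ be the rotation by $\alpha=(\alpha_1,\dots,\alpha_d)$. For $m\in\mathbb Z$ let $\varphi^{(m)}(x)=\varphi(x)+\varphi(Tx)+\dots+\varphi(T^{m-1}x)$ if $m>0$, $\varphi^{(0)}=0$, and $\varphi^{(m)}(x)=-(\varphi(T^{-1}x)+\dots+\varphi(T^{m}x))$ if $m<0$, and let $D(\alpha,\varphi)$ be the set of all $x\in\mathbb T^d$ with $|\varphi^{(m)}(x)|\to+\infty$ as $m\to\pm\infty$. Then $\dim_H F^{(j)}\ge \frac{1}{1+a^d}$ for every $1\le j\le d$. Moreover $$F^{(1)}\times\dots\times F^{(d)}\subset D(\alpha,\varphi)\qquad\text{and}\qquad \dim_H\bigl(F^{(1)}\times\dots\times F^{(d)}\bigr)\ge\frac{d}{1+a^d}>0 .$$ -/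

import Mathlib

noncomputable section

/-- The denominator `q_n` of the `n`-th convergent of the continued fraction of `α`
(`q_0 = 1`, `q_n = a_n q_{n-1} + q_{n-2}`), as a real number. -/
def cfDen (α : ℝ) (n : ℕ) : ℝ := (GenContFract.of α).dens n

/-- The number `ā = 2 a^{d-1} - a^d - 1`. -/
def aBar (d : ℕ) (a : ℝ) : ℝ := 2 * a ^ (d - 1) - a ^ d - 1

/-- The denominator following `q_n^{(j)}` in the order
`q_n^{(1)}, …, q_n^{(d)}, q_{n+1}^{(1)}, …`; the indices `1, …, d` are `0, …, d - 1` here. -/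
def nextCfDen {d : ℕ} (α : Fin d → ℝ) (n : ℕ) (j : Fin d) : ℝ :=
  if h : (j : ℕ) + 1 < d then cfDen (α ⟨(j : ℕ) + 1, h⟩) n
  else cfDen (α ⟨0, Nat.zero_lt_of_lt j.isLt⟩) (n + 1)

/-- The denominators of the irrational numbers `α_1, …, α_d` satisfy
`4 (q_n^{(j)})^a ≤ q_n^{(j+1)} ≤ C (q_n^{(j)})^a` for `1 ≤ j ≤ d` and `n ≥ 1`, where
`q_n^{(d+1)} = q_{n+1}^{(1)}` and `C = 2 ⌈4^{a+2}⌉`. -/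
def InterlacedDenominators {d : ℕ} (a : ℝ) (α : Fin d → ℝ) : Prop :=
  (∀ j, Irrational (α j)) ∧
  ∀ n : ℕ, 1 ≤ n → ∀ j : Fin d,
    4 * cfDen (α j) n ^ a ≤ nextCfDen α n j ∧
    nextCfDen α n j ≤ (2 * ⌈(4 : ℝ) ^ (a + 2)⌉₊ : ℝ) * cfDen (α j) n ^ a

/-- The representative in `[0, 1)` of a point of the circle `ℝ / ℤ`. -/
def circleRep (x : UnitAddCircle) : ℝ := (AddCircle.equivIco 1 0 x : ℝ)

/-- `f_n(x) = q_{n+1} / q_n^{1 + ā - ε} * (1 - cos (2 π q_n x))`. -/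
def bump (abar ε α : ℝ) (n : ℕ) (x : UnitAddCircle) : ℝ :=
  cfDen α (n + 1) / cfDen α n ^ (1 + abar - ε) *
    (1 - Real.cos (2 * Real.pi * cfDen α n * circleRep x))

/-- `φ_α(x) = ∑_{n ≥ 1} (f_n(x + α) - f_n(x))`. -/
def circleCocycle (abar ε α : ℝ) (x : UnitAddCircle) : ℝ :=
  ∑' n : ℕ, (bump abar ε α (n + 1) (x + (α : UnitAddCircle)) - bump abar ε α (n + 1) x)

/-- `φ(x_1, …, x_d) = φ_1(x_1) + … + φ_d(x_d)`. -/
def torusCocycle {d : ℕ} (abar ε : ℝ) (α : Fin d → ℝ) (x : Fin d → UnitAddCircle) : ℝ :=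
  ∑ j, circleCocycle abar ε (α j) (x j)

/-- The cocycle sums `φ^{(m)}`, `m ∈ ℤ`, over the rotation `T x = x + v`:
`φ^{(m)}(x) = φ(x) + φ(T x) + … + φ(T^{m-1} x)` for `m ≥ 0` and
`φ^{(m)}(x) = -(φ(T^{-1} x) + … + φ(T^m x))` for `m < 0`. -/
def cocycleSum {G : Type*} [AddCommGroup G] (v : G) (φ : G → ℝ) : ℤ → G → ℝ
  | Int.ofNat m, x => ∑ k ∈ Finset.range m, φ (x + k • v)
  | Int.negSucc m, x => -∑ k ∈ Finset.range (m + 1), φ (x - (k + 1) • v)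

/-- `D(α, φ)`: the points `x` of the torus with `|φ^{(m)}(x)| → +∞` as `m → ±∞`. -/
def discreteOrbitSet {d : ℕ} (α : Fin d → ℝ) (φ : (Fin d → UnitAddCircle) → ℝ) :
    Set (Fin d → UnitAddCircle) :=
  {x | Filter.Tendsto (fun m : ℤ => |cocycleSum (fun j => (α j : UnitAddCircle)) φ m x|)
      Filter.atTop Filter.atTop ∧
    Filter.Tendsto (fun m : ℤ => |cocycleSum (fun j => (α j : UnitAddCircle)) φ m x|)
      Filter.atBot Filter.atTop}

/-- The Cantor-type set
`⋂_{n ≥ 1} ⋃_{0 ≤ l < q_n} (l / q_n + [-1 / √(q_n q_{n+1}), 1 / √(q_n q_{n+1})])`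
in the circle `ℝ / ℤ`. -/
def cantorTypeSet (α : ℝ) : Set UnitAddCircle :=
  ⋂ n : ℕ, ⋂ _ : 1 ≤ n, ⋃ l : ℕ, ⋃ _ : (l : ℝ) < cfDen α n,
    (fun t : ℝ => (t : UnitAddCircle)) ''
      Set.Icc ((l : ℝ) / cfDen α n - 1 / √(cfDen α n * cfDen α (n + 1)))
        ((l : ℝ) / cfDen α n + 1 / √(cfDen α n * cfDen α (n + 1)))

end

/-!
Write `f_n` for the bumps of all coordinates. The cocycle sums of coboundaries telescope, so
`φ^{(m)}(x) + ∑ f_n(x) = ∑ f_n(x + m α)`, where `∑ f_n(x)` converges for `x` in the product of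
the Cantor-type sets. Hence it suffices to find one large term `f_n(x_j + m α_j)` for every large
`|m|`. Let `Q_0 < Q_1 < …` be all the denominators in their interlaced order and choose `k` with
`Q_{k+d-1} < 4|m| ≤ Q_{k+d}`. Since `1 + ā = a^{d-1} (2 - a)`, the growth conditions give
`Q_k^{1+ā} Q_{k+d} ≤ C Q_{k+d-1}^2 < C (4m)^2`. As `Q_k` and `Q_{k+d}` are consecutive denominators
of the same `α_j` and `4|m|` is below the second, the distance of `Q_k m α_j` to `ℤ` is comparable
to `|m| / Q_{k+d}`, which dominates the distance of `Q_k x_j` to `ℤ`. So the bump at `Q_k` is at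
least of order `m^2 / (Q_k^{1+ā-ε} Q_{k+d})`, hence of order `Q_k^ε`.

For the dimension, a mixed radix expansion with `≈ √(q_{n+1} / q_n)` digits at level `n`
parametrises a part of each Cantor-type set by `[0, 1)`. The inverse of the parametrisation is
`s`-Hölder for every `s < 1 / (1 + a^d)`, and so is the inverse of the product of the
parametrisations, whose image in the product set therefore has dimension at least `d s`.
-/

open Filter Topology
open scoped NNReal ENNReal

noncomputable section

/-! ### Convergents of irrational numbers -/

section Convergents

variable {α : ℝ}

theorem not_terminatedAt_of_irrational (h : Irrational α) (n : ℕ) :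
    ¬(GenContFract.of α).TerminatedAt n := fun ht =>
  let ⟨q, hq⟩ := (GenContFract.terminates_iff_rat α).1 ⟨n, ht⟩
  h ⟨q, hq.symm⟩

theorem exists_int_contsAux_eq (h : Irrational α) (n : ℕ) :
    ∃ p q : ℤ, (GenContFract.of α).contsAux n = ⟨(p : ℝ), (q : ℝ)⟩ := by
  induction n using Nat.twoStepInduction with
  | zero => exact ⟨1, 0, by simp [GenContFract.contsAux]⟩
  | one => exact ⟨⌊α⌋, 1, by simp [GenContFract.contsAux, GenContFract.of_h_eq_floor]⟩
  | more n ih ih' =>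
    obtain ⟨p, q, hpq⟩ := ih
    obtain ⟨p', q', hpq'⟩ := ih'
    obtain ⟨gp, hgp⟩ := Option.ne_none_iff_exists'.1 (not_terminatedAt_of_irrational h n)
    obtain ⟨ha, z, hb⟩ := GenContFract.of_partNum_eq_one_and_exists_int_partDen_eq hgp
    refine ⟨z * p' + p, z * q' + q, ?_⟩
    rw [GenContFract.contsAux_recurrence hgp hpq hpq', ha, hb]
    push_cast
    simp only [one_mul]

theorem one_le_cfDen (h : Irrational α) (n : ℕ) : 1 ≤ cfDen α n := by
  have hfib : (Nat.fib (n + 1) : ℝ) ≤ cfDen α n :=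
    GenContFract.succ_nth_fib_le_of_nth_den (Or.inr (not_terminatedAt_of_irrational h _))
  exact le_trans (mod_cast Nat.fib_pos.2 n.succ_pos) hfib

theorem cfDen_pos (h : Irrational α) (n : ℕ) : 0 < cfDen α n :=
  zero_lt_one.trans_le (one_le_cfDen h n)

/-- The denominator `q_n` as a natural number, so that it can act on `ℝ / ℤ` by multiplication. -/
def cfDenNat (α : ℝ) (n : ℕ) : ℕ := ⌊cfDen α n⌋₊

theorem natCast_cfDenNat (h : Irrational α) (n : ℕ) : (cfDenNat α n : ℝ) = cfDen α n := by
  obtain ⟨p, q, hpq⟩ := exists_int_contsAux_eq h (n + 1)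
  have hq : cfDen α n = q := by
    rw [cfDen, GenContFract.den_eq_conts_b, GenContFract.nth_cont_eq_succ_nth_contAux, hpq]
  have hq0 : (0 : ℤ) ≤ q := by exact_mod_cast hq ▸ (cfDen_pos h n).le
  lift q to ℕ using hq0
  rw [cfDenNat, hq, Int.cast_natCast, Nat.floor_natCast]

theorem exists_int_nums_eq (h : Irrational α) (n : ℕ) :
    ∃ p : ℤ, (GenContFract.of α).nums n = p := by
  obtain ⟨p, q, hpq⟩ := exists_int_contsAux_eq h (n + 1)
  exact ⟨p, by rw [GenContFract.num_eq_conts_a, GenContFract.nth_cont_eq_succ_nth_contAux, hpq]⟩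

theorem two_mul_cfDen_le (h : Irrational α) (n : ℕ) : 2 * cfDen α n ≤ cfDen α (n + 2) := by
  obtain ⟨b, hb⟩ := Option.ne_none_iff_exists'.1 <|
    mt GenContFract.terminatedAt_iff_partDen_none.2 (not_terminatedAt_of_irrational h (n + 1))
  have hb1 : 1 ≤ b := GenContFract.of_one_le_get?_partDen hb
  obtain ⟨gp, hgp, rfl⟩ := GenContFract.exists_s_b_of_partDen hb
  have hrec : cfDen α (n + 2) = gp.b * cfDen α (n + 1) + gp.a * cfDen α n :=
    GenContFract.dens_recurrence hgp rfl rfl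
  have hmono : cfDen α n ≤ cfDen α (n + 1) := GenContFract.of_den_mono
  rw [hrec, (GenContFract.of_partNum_eq_one_and_exists_int_partDen_eq hgp).1]
  nlinarith [one_le_cfDen h (n + 1)]

theorem abs_cfDen_mul_sub_nums_le (h : Irrational α) (n : ℕ) :
    |cfDen α n * α - (GenContFract.of α).nums n| ≤ 1 / cfDen α (n + 1) := by
  have hq := cfDen_pos h n
  have hq' := cfDen_pos h (n + 1)
  have hconv : |α - (GenContFract.of α).nums n / cfDen α n| ≤
      1 / (cfDen α n * cfDen α (n + 1)) :=
    GenContFract.conv_eq_num_div_den (g := GenContFract.of α) (n := n) ▸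
      GenContFract.abs_sub_convs_le (not_terminatedAt_of_irrational h n)
  calc |cfDen α n * α - (GenContFract.of α).nums n|
      = |cfDen α n * (α - (GenContFract.of α).nums n / cfDen α n)| := by
        rw [mul_sub, mul_div_cancel₀ _ hq.ne']
    _ = cfDen α n * |α - (GenContFract.of α).nums n / cfDen α n| := by
        rw [abs_mul, abs_of_pos hq]
    _ ≤ cfDen α n * (1 / (cfDen α n * cfDen α (n + 1))) := by gcongr
    _ = 1 / cfDen α (n + 1) := by field_simp

theorem le_abs_cfDen_mul_sub_nums (h : Irrational α) (n : ℕ) :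
    1 / (2 * cfDen α (n + 1)) ≤ |cfDen α n * α - (GenContFract.of α).nums n| := by
  have hq := cfDen_pos h n
  have hq' := cfDen_pos h (n + 1)
  have hq'' := cfDen_pos h (n + 2)
  have hdet : (GenContFract.of α).nums n * cfDen α (n + 1)
      - cfDen α n * (GenContFract.of α).nums (n + 1) = (-1) ^ (n + 1) :=
    SimpContFract.determinant (s := SimpContFract.of α) (not_terminatedAt_of_irrational h n)
  have happrox := abs_cfDen_mul_sub_nums_le h (n + 1)
  set u := cfDen α n * α - (GenContFract.of α).nums n
  set v := cfDen α (n + 1) * α - (GenContFract.of α).nums (n + 1)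
  have huv : cfDen α n * v - cfDen α (n + 1) * u = (-1) ^ (n + 1) := by
    rw [← hdet]; simp only [u, v]; ring
  have hsum : 1 ≤ cfDen α n * |v| + cfDen α (n + 1) * |u| :=
    calc (1 : ℝ) = |cfDen α n * v - cfDen α (n + 1) * u| := by simp [huv]
      _ ≤ |cfDen α n * v| + |cfDen α (n + 1) * u| := abs_sub _ _
      _ = cfDen α n * |v| + cfDen α (n + 1) * |u| := by
        rw [abs_mul, abs_mul, abs_of_pos hq, abs_of_pos hq']
  have hv : cfDen α n * |v| ≤ 1 / 2 :=
    calc cfDen α n * |v| ≤ cfDen α n * (1 / cfDen α (n + 2)) := by gcongr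
      _ ≤ 1 / 2 := by
        rw [mul_one_div, div_le_div_iff₀ hq'' two_pos]
        linarith [two_mul_cfDen_le h n]
  rw [div_le_iff₀ (by positivity)]
  linarith

theorem cfDenNat_nsmul_coe (h : Irrational α) (n : ℕ) :
    cfDenNat α n • (α : UnitAddCircle) =
      ((cfDen α n * α - (GenContFract.of α).nums n : ℝ) : UnitAddCircle) := by
  obtain ⟨p, hp⟩ := exists_int_nums_eq h n
  have hp0 : ((p : ℝ) : UnitAddCircle) = 0 := (AddCircle.coe_eq_zero_iff 1).2 ⟨p, by simp⟩
  rw [← AddCircle.coe_nsmul, nsmul_eq_mul, natCast_cfDenNat h, hp, AddCircle.coe_sub, hp0, sub_zero]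

theorem norm_cfDenNat_nsmul_coe_le (h : Irrational α) (n : ℕ) :
    ‖cfDenNat α n • (α : UnitAddCircle)‖ ≤ 1 / cfDen α (n + 1) := by
  rw [cfDenNat_nsmul_coe h]
  exact (QuotientAddGroup.norm_mk_le_norm).trans (abs_cfDen_mul_sub_nums_le h n)

theorem le_norm_zsmul_cfDenNat_nsmul_coe (h : Irrational α) {n : ℕ} {m : ℤ}
    (hm : 2 * |(m : ℝ)| ≤ cfDen α (n + 1)) :
    |(m : ℝ)| / (2 * cfDen α (n + 1)) ≤ ‖m • cfDenNat α n • (α : UnitAddCircle)‖ := by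
  have hq' := cfDen_pos h (n + 1)
  set δ := cfDen α n * α - (GenContFract.of α).nums n with hδ
  have hsmall : |m * δ| ≤ 1 / 2 :=
    calc |m * δ| ≤ |(m : ℝ)| * (1 / cfDen α (n + 1)) := by
          rw [abs_mul]; gcongr; exact abs_cfDen_mul_sub_nums_le h n
      _ ≤ 1 / 2 := by rw [mul_one_div, div_le_div_iff₀ hq' two_pos]; linarith
  have hnorm : ‖m • cfDenNat α n • (α : UnitAddCircle)‖ = |m * δ| := by
    rw [cfDenNat_nsmul_coe h, ← hδ, ← AddCircle.coe_zsmul, zsmul_eq_mul]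
    exact (AddCircle.norm_coe_eq_abs_iff _ one_ne_zero).2 (by rwa [abs_one])
  calc |(m : ℝ)| / (2 * cfDen α (n + 1)) = |(m : ℝ)| * (1 / (2 * cfDen α (n + 1))) := by
        rw [mul_one_div]
    _ ≤ |(m : ℝ)| * |δ| := by gcongr; exact le_abs_cfDen_mul_sub_nums h n
    _ = ‖m • cfDenNat α n • (α : UnitAddCircle)‖ := by rw [hnorm, abs_mul]

theorem sqrt_two_pow_le_two_mul_cfDen (h : Irrational α) (n : ℕ) : √2 ^ n ≤ 2 * cfDen α n := by
  induction n using Nat.twoStepInduction with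
  | zero => linarith [one_le_cfDen h 0]
  | one => linarith [one_le_cfDen h 1, Real.sqrt_two_lt_three_halves]
  | more n ih _ =>
    rw [pow_add, Real.sq_sqrt two_pos.le]
    linarith [two_mul_cfDen_le h n]

theorem summable_const_div_cfDen_rpow (h : Irrational α) (c : ℝ) {s : ℝ} (hs : 0 < s) :
    Summable fun n => c / cfDen α n ^ s := by
  have hratio : (√2 ^ s)⁻¹ < 1 := inv_lt_one_of_one_lt₀ (Real.one_lt_rpow Real.one_lt_sqrt_two hs)
  have hbound (n : ℕ) : (cfDen α n ^ s)⁻¹ ≤ 2 ^ s * (√2 ^ s)⁻¹ ^ n := by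
    have hq := cfDen_pos h n
    have hpow : (√2 ^ s) ^ n ≤ 2 ^ s * cfDen α n ^ s := by
      rw [Real.rpow_pow_comm (by positivity), ← Real.mul_rpow two_pos.le hq.le]
      exact Real.rpow_le_rpow (by positivity) (sqrt_two_pow_le_two_mul_cfDen h n) hs.le
    rw [inv_pow, ← div_eq_mul_inv, inv_eq_one_div, div_le_div_iff₀ (by positivity) (by positivity),
      one_mul]
    exact hpow
  simp only [div_eq_mul_inv]
  exact .mul_left c <| .of_nonneg_of_le
    (fun n => inv_nonneg.2 (Real.rpow_nonneg (cfDen_pos h n).le s)) hbound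
    ((summable_geometric_of_lt_one (by positivity) hratio).mul_left _)

end Convergents

/-! ### Bumps in terms of the norm of the circle -/

section Bump

theorem cos_two_pi_mul_norm_coe (t : ℝ) :
    Real.cos (2 * Real.pi * ‖(t : UnitAddCircle)‖) = Real.cos (2 * Real.pi * t) := by
  rw [UnitAddCircle.norm_eq, ← Real.cos_sub_int_mul_two_pi (2 * Real.pi * t) (round t),
    ← Real.cos_abs (_ - _)]
  congr 1
  rw [mul_comm (round t : ℝ), ← mul_sub, abs_mul, abs_of_pos Real.two_pi_pos]

theorem unitAddCircle_norm_le_half (y : UnitAddCircle) : ‖y‖ ≤ 1 / 2 := by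
  simpa only [abs_one] using AddCircle.norm_le_half_period 1 (x := y) one_ne_zero

theorem mul_norm_sq_le_one_sub_cos (y : UnitAddCircle) :
    8 * ‖y‖ ^ 2 ≤ 1 - Real.cos (2 * Real.pi * ‖y‖) := by
  have hpi := Real.pi_pos
  have hcos := Real.cos_le_one_sub_mul_cos_sq (x := 2 * Real.pi * ‖y‖) <| by
    rw [abs_of_nonneg (by positivity)]
    nlinarith [unitAddCircle_norm_le_half y]
  have hcoeff : 2 / Real.pi ^ 2 * (2 * Real.pi * ‖y‖) ^ 2 = 8 * ‖y‖ ^ 2 := by field_simp; ring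
  linarith

theorem one_sub_cos_le_mul_norm_sq (y : UnitAddCircle) :
    1 - Real.cos (2 * Real.pi * ‖y‖) ≤ 2 * Real.pi ^ 2 * ‖y‖ ^ 2 := by
  linarith [Real.one_sub_sq_div_two_le_cos (x := 2 * Real.pi * ‖y‖)]

theorem abs_cos_norm_sub_cos_norm_le (y z : UnitAddCircle) :
    |Real.cos (2 * Real.pi * ‖y‖) - Real.cos (2 * Real.pi * ‖z‖)| ≤ 2 * Real.pi * ‖y - z‖ :=
  calc _ ≤ |2 * Real.pi * ‖y‖ - 2 * Real.pi * ‖z‖| := Real.abs_cos_sub_cos_le _ _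
    _ = 2 * Real.pi * |‖y‖ - ‖z‖| := by rw [← mul_sub, abs_mul, abs_of_pos Real.two_pi_pos]
    _ ≤ 2 * Real.pi * ‖y - z‖ := by gcongr; exact abs_norm_sub_norm_le y z

variable {α : ℝ} (h : Irrational α) (b ε : ℝ) {n : ℕ} {x : UnitAddCircle}
include h

theorem bump_eq (n : ℕ) (x : UnitAddCircle) :
    bump b ε α n x = cfDen α (n + 1) / cfDen α n ^ (1 + b - ε) *
      (1 - Real.cos (2 * Real.pi * ‖cfDenNat α n • x‖)) := by
  have hx : ((circleRep x : ℝ) : UnitAddCircle) = x := (AddCircle.equivIco 1 0).symm_apply_apply x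
  conv_rhs => rw [← hx, ← AddCircle.coe_nsmul, cos_two_pi_mul_norm_coe, nsmul_eq_mul,
    natCast_cfDenNat h, ← mul_assoc]
  rfl

theorem bump_nonneg (n : ℕ) (x : UnitAddCircle) : 0 ≤ bump b ε α n x := by
  have hq := cfDen_pos h n
  have hq' := cfDen_pos h (n + 1)
  exact mul_nonneg (by positivity) (sub_nonneg.2 (Real.cos_le_one _))

theorem abs_bump_add_sub_bump_le (n : ℕ) (x : UnitAddCircle) :
    |bump b ε α n (x + (α : UnitAddCircle)) - bump b ε α n x| ≤
      2 * Real.pi / cfDen α n ^ (1 + b - ε) := by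
  have hq := cfDen_pos h n
  have hq' := cfDen_pos h (n + 1)
  have hcos := abs_cos_norm_sub_cos_norm_le (cfDenNat α n • x)
    (cfDenNat α n • (x + (α : UnitAddCircle)))
  rw [← smul_sub, sub_add_cancel_left, smul_neg, norm_neg] at hcos
  rw [bump_eq h, bump_eq h, ← mul_sub, sub_sub_sub_cancel_left, abs_mul,
    abs_of_pos (by positivity)]
  calc _ ≤ cfDen α (n + 1) / cfDen α n ^ (1 + b - ε) *
        (2 * Real.pi * (1 / cfDen α (n + 1))) := by
        gcongr
        refine hcos.trans ?_
        gcongr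
        exact norm_cfDenNat_nsmul_coe_le h n
    _ = 2 * Real.pi / cfDen α n ^ (1 + b - ε) := by field_simp

theorem norm_cfDenNat_nsmul_sq_le (hx : x ∈ cantorTypeSet α) (hn : 1 ≤ n) :
    ‖cfDenNat α n • x‖ ^ 2 ≤ cfDen α n / cfDen α (n + 1) := by
  have hq := cfDen_pos h n
  have hq' := cfDen_pos h (n + 1)
  simp only [cantorTypeSet, Set.mem_iInter, Set.mem_iUnion] at hx
  obtain ⟨l, -, t, ⟨hlow, hup⟩, rfl⟩ := hx n hn
  have ht : |t - l / cfDen α n| ≤ 1 / √(cfDen α n * cfDen α (n + 1)) :=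
    abs_le.2 ⟨by linarith, by linarith⟩
  have hl : ((l : ℝ) : UnitAddCircle) = 0 := (AddCircle.coe_eq_zero_iff 1).2 ⟨l, by simp⟩
  have hnorm : ‖cfDenNat α n • (t : UnitAddCircle)‖ ≤ cfDen α n * |t - l / cfDen α n| :=
    calc ‖cfDenNat α n • (t : UnitAddCircle)‖
        = ‖((cfDen α n * (t - l / cfDen α n) : ℝ) : UnitAddCircle)‖ := by
          rw [mul_sub, mul_div_cancel₀ _ hq.ne', AddCircle.coe_sub, hl, sub_zero,
            ← natCast_cfDenNat h, ← nsmul_eq_mul, AddCircle.coe_nsmul]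
      _ ≤ |cfDen α n * (t - l / cfDen α n)| := QuotientAddGroup.norm_mk_le_norm
      _ = cfDen α n * |t - l / cfDen α n| := by rw [abs_mul, abs_of_pos hq]
  calc ‖cfDenNat α n • (t : UnitAddCircle)‖ ^ 2
      ≤ (cfDen α n * (1 / √(cfDen α n * cfDen α (n + 1)))) ^ 2 := by
        gcongr; exact hnorm.trans (by gcongr)
    _ = cfDen α n / cfDen α (n + 1) := by
        rw [mul_pow, div_pow, Real.sq_sqrt (by positivity)]; field_simp

theorem bump_le_of_mem_cantorTypeSet (hx : x ∈ cantorTypeSet α) (hn : 1 ≤ n) :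
    bump b ε α n x ≤ 2 * Real.pi ^ 2 / cfDen α n ^ (b - ε) := by
  have hq := cfDen_pos h n
  have hq' := cfDen_pos h (n + 1)
  rw [bump_eq h]
  calc _ ≤ cfDen α (n + 1) / cfDen α n ^ (1 + b - ε) *
        (2 * Real.pi ^ 2 * (cfDen α n / cfDen α (n + 1))) := by
        gcongr
        refine (one_sub_cos_le_mul_norm_sq _).trans ?_
        gcongr
        exact norm_cfDenNat_nsmul_sq_le h hx hn
    _ = 2 * Real.pi ^ 2 / cfDen α n ^ (b - ε) := by
        rw [add_sub_assoc, Real.rpow_add hq, Real.rpow_one]; field_simp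

theorem le_norm_cfDenNat_nsmul_add_zsmul (hx : x ∈ cantorTypeSet α) (hn : 1 ≤ n) {m : ℤ}
    (hm : 2 * |(m : ℝ)| ≤ cfDen α (n + 1))
    (hm' : 16 * (cfDen α n * cfDen α (n + 1)) ≤ (m : ℝ) ^ 2) :
    |(m : ℝ)| / (4 * cfDen α (n + 1)) ≤ ‖cfDenNat α n • (x + m • (α : UnitAddCircle))‖ := by
  have hq' := cfDen_pos h (n + 1)
  have hxnorm : ‖cfDenNat α n • x‖ ≤ |(m : ℝ)| / (4 * cfDen α (n + 1)) := by
    refine le_of_sq_le_sq ((norm_cfDenNat_nsmul_sq_le h hx hn).trans ?_) (by positivity)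
    rw [div_pow, sq_abs, div_le_div_iff₀ hq' (by positivity)]
    nlinarith
  have hhalf : |(m : ℝ)| / (2 * cfDen α (n + 1)) = |(m : ℝ)| / (4 * cfDen α (n + 1)) +
      |(m : ℝ)| / (4 * cfDen α (n + 1)) := by field_simp; ring
  calc |(m : ℝ)| / (4 * cfDen α (n + 1))
      ≤ ‖m • cfDenNat α n • (α : UnitAddCircle)‖ - ‖cfDenNat α n • x‖ := by
        linarith [le_norm_zsmul_cfDenNat_nsmul_coe h hm]
    _ ≤ ‖m • cfDenNat α n • (α : UnitAddCircle) + cfDenNat α n • x‖ := norm_sub_le_norm_add _ _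
    _ = ‖cfDenNat α n • (x + m • (α : UnitAddCircle))‖ := by rw [smul_add, smul_comm, add_comm]

theorem le_bump_add_zsmul (hx : x ∈ cantorTypeSet α) (hn : 1 ≤ n) {m : ℤ}
    (hm : 2 * |(m : ℝ)| ≤ cfDen α (n + 1))
    (hm' : 16 * (cfDen α n * cfDen α (n + 1)) ≤ (m : ℝ) ^ 2) :
    (m : ℝ) ^ 2 / (2 * (cfDen α n ^ (1 + b - ε) * cfDen α (n + 1))) ≤
      bump b ε α n (x + m • (α : UnitAddCircle)) := by
  have hq := cfDen_pos h n
  have hq' := cfDen_pos h (n + 1)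
  rw [bump_eq h]
  calc (m : ℝ) ^ 2 / (2 * (cfDen α n ^ (1 + b - ε) * cfDen α (n + 1)))
      = cfDen α (n + 1) / cfDen α n ^ (1 + b - ε) *
          (8 * (|(m : ℝ)| / (4 * cfDen α (n + 1))) ^ 2) := by
        rw [div_pow, sq_abs]; field_simp; ring
    _ ≤ _ := by
        gcongr
        refine le_trans ?_ (mul_norm_sq_le_one_sub_cos _)
        gcongr
        exact le_norm_cfDenNat_nsmul_add_zsmul h hx hn hm hm'

end Bump

/-! ### Cocycle sums of coboundaries -/

section Cocycle

theorem cocycleSum_coboundary {G : Type*} [AddCommGroup G] (v : G) (f : G → ℝ) (m : ℤ) (x : G) :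
    cocycleSum v (fun y => f (y + v) - f y) m x = f (x + m • v) - f x := by
  match m with
  | Int.ofNat m =>
    simpa [cocycleSum, succ_nsmul, add_assoc] using
      Finset.sum_range_sub (fun k : ℕ => f (x + k • v)) m
  | Int.negSucc m =>
    rw [cocycleSum, ← Finset.sum_neg_distrib]
    simpa [succ_nsmul, ← sub_sub, sub_eq_add_neg, add_assoc] using
      Finset.sum_range_sub (fun k : ℕ => f (x - k • v)) (m + 1)

theorem hasSum_cocycleSum {G : Type*} [AddCommGroup G] (v : G) {φ : ℕ → G → ℝ}
    (hφ : ∀ x, Summable fun n => φ n x) (m : ℤ) (x : G) :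
    HasSum (fun n => cocycleSum v (φ n) m x) (cocycleSum v (fun y => ∑' n, φ n y) m x) :=
  match m with
  | Int.ofNat _ => hasSum_sum fun _ _ => (hφ _).hasSum
  | Int.negSucc _ => (hasSum_sum fun _ _ => (hφ _).hasSum).neg

theorem cocycleSum_pi {ι : Type*} [Fintype ι] {G : ι → Type*} [∀ i, AddCommGroup (G i)]
    (v : ∀ i, G i) (φ : ∀ i, G i → ℝ) (m : ℤ) (x : ∀ i, G i) :
    cocycleSum v (fun y => ∑ i, φ i (y i)) m x = ∑ i, cocycleSum (v i) (φ i) m (x i) := by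
  match m with
  | Int.ofNat m => exact Finset.sum_comm
  | Int.negSucc m =>
    simp only [cocycleSum, Finset.sum_neg_distrib]
    rw [Finset.sum_comm]
    rfl

theorem hasSum_bump_add_zsmul {α : ℝ} (h : Irrational α) {b ε : ℝ} (hε : ε < b)
    {x : UnitAddCircle} (hx : x ∈ cantorTypeSet α) (m : ℤ) :
    HasSum (fun n => bump b ε α (n + 1) (x + m • (α : UnitAddCircle)))
      (cocycleSum (α : UnitAddCircle) (circleCocycle b ε α) m x
        + ∑' n, bump b ε α (n + 1) x) := by
  have hdiff (y : UnitAddCircle) : Summable fun n =>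
      bump b ε α (n + 1) (y + (α : UnitAddCircle)) - bump b ε α (n + 1) y :=
    .of_norm_bounded ((summable_nat_add_iff 1).2
      (summable_const_div_cfDen_rpow h _ (by linarith : 0 < 1 + b - ε)))
      fun n => abs_bump_add_sub_bump_le h b ε (n + 1) y
  have hbump : Summable fun n => bump b ε α (n + 1) x :=
    .of_nonneg_of_le (fun n => bump_nonneg h b ε (n + 1) x)
      (fun n => bump_le_of_mem_cantorTypeSet h b ε hx n.succ_pos)
      ((summable_nat_add_iff 1).2 (summable_const_div_cfDen_rpow h _ (sub_pos.2 hε)))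
  have htotal := (hasSum_cocycleSum (α : UnitAddCircle) hdiff m x).add hbump.hasSum
  simp only [cocycleSum_coboundary _ (bump b ε α _), sub_add_cancel] at htotal
  exact htotal

theorem bump_le_cocycleSum_torusCocycle_add {d : ℕ} {α : Fin d → ℝ} (h : ∀ j, Irrational (α j))
    {b ε : ℝ} (hε : ε < b) {x : Fin d → UnitAddCircle} (hx : ∀ j, x j ∈ cantorTypeSet (α j))
    (m : ℤ) (j : Fin d) (n : ℕ) :
    bump b ε (α j) (n + 1) (x j + m • (α j : UnitAddCircle)) ≤
      cocycleSum (fun j => (α j : UnitAddCircle)) (torusCocycle b ε α) m x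
        + ∑ j, ∑' n, bump b ε (α j) (n + 1) (x j) := by
  have hsum (i : Fin d) := hasSum_bump_add_zsmul (h i) hε (hx i) m
  have hnonneg (i : Fin d) (n : ℕ) :=
    bump_nonneg (h i) b ε (n + 1) (x i + m • (α i : UnitAddCircle))
  calc bump b ε (α j) (n + 1) (x j + m • (α j : UnitAddCircle))
      ≤ cocycleSum (α j : UnitAddCircle) (circleCocycle b ε (α j)) m (x j)
          + ∑' n, bump b ε (α j) (n + 1) (x j) := le_hasSum (hsum j) n fun k _ => hnonneg j k
    _ ≤ ∑ i, (cocycleSum (α i : UnitAddCircle) (circleCocycle b ε (α i)) m (x i)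
          + ∑' n, bump b ε (α i) (n + 1) (x i)) :=
        Finset.single_le_sum (fun i _ => (hsum i).nonneg (hnonneg i)) (Finset.mem_univ j)
    _ = cocycleSum (fun j => (α j : UnitAddCircle)) (torusCocycle b ε α) m x
          + ∑ j, ∑' n, bump b ε (α j) (n + 1) (x j) := by
        rw [Finset.sum_add_distrib]
        congr 1
        exact (cocycleSum_pi (fun j => (α j : UnitAddCircle))
          (fun j => circleCocycle b ε (α j)) m x).symm

end Cocycle

/-! ### Sequences of power growth -/

/-- `Q` grows like iterates of `x ↦ x ^ a`: each term is the `a`-th power of the preceding one up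
to a factor between `c` and `C`. The interlaced denominators grow in this way, and so do the
denominators of each `α_j`. -/
structure PowerGrowth (a c C : ℝ) (Q : ℕ → ℝ) : Prop where
  one_lt_exponent : 1 < a
  one_lt_const : 1 < c
  one_le : ∀ k, 1 ≤ Q k
  mul_rpow_le : ∀ k, c * Q k ^ a ≤ Q (k + 1)
  le_mul_rpow : ∀ k, Q (k + 1) ≤ C * Q k ^ a

namespace PowerGrowth

variable {a c C : ℝ} {Q : ℕ → ℝ} (hQ : PowerGrowth a c C Q)
include hQ

theorem pos (k : ℕ) : 0 < Q k := zero_lt_one.trans_le (hQ.one_le k)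

theorem const_pos : 0 < C :=
  pos_of_mul_pos_left ((hQ.pos 1).trans_le (hQ.le_mul_rpow 0))
    (Real.rpow_nonneg (hQ.pos 0).le a)

theorem mul_le (k : ℕ) : c * Q k ≤ Q (k + 1) := by
  have hc := hQ.one_lt_const
  calc c * Q k ≤ c * Q k ^ a := by
        gcongr; exact Real.self_le_rpow_of_one_le (hQ.one_le k) hQ.one_lt_exponent.le
    _ ≤ Q (k + 1) := hQ.mul_rpow_le k

theorem strictMono : StrictMono Q := strictMono_nat_of_lt_succ fun k =>
  (lt_mul_of_one_lt_left (hQ.pos k) hQ.one_lt_const).trans_le (hQ.mul_le k)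

theorem tendsto_atTop : Tendsto Q atTop atTop :=
  tendsto_atTop_of_geom_le (hQ.pos 0) hQ.one_lt_const hQ.mul_le

theorem eventually_le_rpow {s : ℝ} (hs : 0 < s) (B : ℝ) : ∀ᶠ k in atTop, B ≤ Q k ^ s :=
  ((tendsto_rpow_atTop hs).comp hQ.tendsto_atTop).eventually_ge_atTop B

theorem pow_mul_rpow_pow_le (k i : ℕ) : c ^ i * Q k ^ a ^ i ≤ Q (k + i) := by
  have hc := hQ.one_lt_const
  have ha := hQ.one_lt_exponent
  have hk := hQ.pos k
  induction i with
  | zero => simp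
  | succ i ih =>
    calc c ^ (i + 1) * Q k ^ a ^ (i + 1) = c * (c ^ i * (Q k ^ a ^ i) ^ a) := by
          rw [← Real.rpow_mul hk.le, pow_succ a, pow_succ' c, mul_assoc]
      _ ≤ c * ((c ^ i) ^ a * (Q k ^ a ^ i) ^ a) := by
          gcongr; exact Real.self_le_rpow_of_one_le (one_le_pow₀ hc.le) ha.le
      _ = c * (c ^ i * Q k ^ a ^ i) ^ a := by rw [Real.mul_rpow (by positivity) (by positivity)]
      _ ≤ c * Q (k + i) ^ a := by gcongr
      _ ≤ Q (k + (i + 1)) := hQ.mul_rpow_le (k + i)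

theorem exists_le_mul_rpow_pow (i : ℕ) : ∃ D : ℝ, 0 ≤ D ∧ ∀ k, Q (k + i) ≤ D * Q k ^ a ^ i := by
  have ha := hQ.one_lt_exponent
  have hC := hQ.const_pos
  induction i with
  | zero => exact ⟨1, zero_le_one, fun k => by simp⟩
  | succ i ih =>
    obtain ⟨D, hD, hle⟩ := ih
    refine ⟨C * D ^ a, by positivity, fun k => ?_⟩
    have hk := hQ.pos k
    have hki := hQ.pos (k + i)
    calc Q (k + (i + 1)) ≤ C * Q (k + i) ^ a := hQ.le_mul_rpow (k + i)
      _ ≤ C * (D * Q k ^ a ^ i) ^ a := by gcongr; exact hle k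
      _ = C * D ^ a * Q k ^ a ^ (i + 1) := by
          rw [Real.mul_rpow hD (by positivity), ← Real.rpow_mul hk.le, pow_succ a, mul_assoc]

theorem exists_subseq {d : ℕ} (hd : d ≠ 0) (j : ℕ) :
    ∃ D, PowerGrowth (a ^ d) (c ^ d) D fun n => Q (d * n + j) := by
  obtain ⟨D, -, hD⟩ := hQ.exists_le_mul_rpow_pow d
  have hshift (n : ℕ) : d * (n + 1) + j = d * n + j + d := by ring
  exact ⟨D, one_lt_pow₀ hQ.one_lt_exponent hd, one_lt_pow₀ hQ.one_lt_const hd,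
    fun n => hQ.one_le _, fun n => hshift n ▸ hQ.pow_mul_rpow_pow_le _ d,
    fun n => hshift n ▸ hD _⟩

theorem rpow_mul_le_mul_sq (ha : a ≤ 2) (k i : ℕ) :
    Q k ^ (a ^ i * (2 - a)) * Q (k + i + 1) ≤ C * Q (k + i) ^ 2 := by
  have hk := hQ.pos k
  have hki := hQ.pos (k + i)
  have hiterate : Q k ^ a ^ i ≤ Q (k + i) :=
    (le_mul_of_one_le_left (by positivity) (one_le_pow₀ hQ.one_lt_const.le)).trans
      (hQ.pow_mul_rpow_pow_le k i)
  calc Q k ^ (a ^ i * (2 - a)) * Q (k + i + 1)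
      = (Q k ^ a ^ i) ^ (2 - a) * Q (k + i + 1) := by rw [Real.rpow_mul hk.le]
    _ ≤ Q (k + i) ^ (2 - a) * (C * Q (k + i) ^ a) := by
        have hnext := hQ.pos (k + i + 1)
        gcongr
        exact hQ.le_mul_rpow (k + i)
    _ = C * Q (k + i) ^ 2 := by
        rw [mul_left_comm, ← Real.rpow_add hki, sub_add_cancel, Real.rpow_two]

theorem eventually_exists_mul_le_sq (ha : a ≤ 2) (i : ℕ) {s : ℝ} (hs : s < a ^ i * (2 - a))
    (B : ℝ) :
    ∀ᶠ y : ℝ in atTop, ∃ k, y ≤ Q (k + i + 1) ∧ B * (Q k ^ s * Q (k + i + 1)) ≤ y ^ 2 := by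
  obtain ⟨k₁, hk₁⟩ := (hQ.eventually_le_rpow (sub_pos.2 hs) (C * B)).exists_forall_of_atTop
  filter_upwards [eventually_gt_atTop (Q (0 + k₁ + i))] with y hy
  have hshift : StrictMono fun n => n + k₁ + i :=
    (strictMono_id.add_const k₁).add_const i
  obtain ⟨n, hlt, hle⟩ := (hQ.strictMono.comp hshift).exists_between_of_tendsto_atTop
    (hQ.tendsto_atTop.comp hshift.tendsto_atTop) hy
  have hindex : n + k₁ + i + 1 = n + 1 + k₁ + i := by omega
  refine ⟨n + k₁, hindex ▸ hle, le_of_mul_le_mul_left ?_ hQ.const_pos⟩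
  set k := n + k₁
  have hk := hQ.pos k
  have hnext := hQ.pos (k + i + 1)
  have hC := hQ.const_pos
  calc C * (B * (Q k ^ s * Q (k + i + 1)))
      ≤ Q k ^ (a ^ i * (2 - a) - s) * (Q k ^ s * Q (k + i + 1)) := by
        rw [← mul_assoc]; gcongr; exact hk₁ k (Nat.le_add_left _ _)
    _ = Q k ^ (a ^ i * (2 - a)) * Q (k + i + 1) := by
        rw [← mul_assoc, ← Real.rpow_add hk, sub_add_cancel]
    _ ≤ C * Q (k + i) ^ 2 := hQ.rpow_mul_le_mul_sq ha k i
    _ ≤ C * y ^ 2 := by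
        have := hQ.pos (k + i)
        gcongr
        exact hlt.le

end PowerGrowth

/-! ### Interlaced denominators -/

section Interlaced

/-- The denominators `q_n^{(j)}`, `n ≥ 1`, in the order
`q_1^{(1)}, …, q_1^{(d)}, q_2^{(1)}, …`. -/
def orderedCfDen {d : ℕ} [NeZero d] (α : Fin d → ℝ) (k : ℕ) : ℝ :=
  cfDen (α (Fin.ofNat d k)) (k / d + 1)

variable {d : ℕ} [NeZero d] {a : ℝ} {α : Fin d → ℝ}

theorem orderedCfDen_add_self (α : Fin d → ℝ) (k : ℕ) :
    orderedCfDen α (k + d) = cfDen (α (Fin.ofNat d k)) (k / d + 2) := by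
  have hindex : Fin.ofNat d (k + d) = Fin.ofNat d k := Fin.ext (Nat.add_mod_right k d)
  rw [orderedCfDen, Nat.add_div_right k (NeZero.pos d), hindex]

theorem orderedCfDen_mul_add (α : Fin d → ℝ) (n : ℕ) (j : Fin d) :
    orderedCfDen α (d * n + j) = cfDen (α j) (n + 1) := by
  have hindex : Fin.ofNat d (d * n + j) = j :=
    Fin.ext ((Nat.mul_add_mod d n j).trans (Nat.mod_eq_of_lt j.isLt))
  rw [orderedCfDen, hindex, Nat.mul_add_div (NeZero.pos d), Nat.div_eq_of_lt j.isLt, add_zero]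

theorem nextCfDen_succ (α : Fin d → ℝ) (n : ℕ) (j : Fin d) :
    nextCfDen α (n + 1) j = orderedCfDen α (d * n + j + 1) := by
  unfold nextCfDen
  split_ifs with h
  · exact (orderedCfDen_mul_add α n ⟨j + 1, h⟩).symm
  · have hindex : d * n + j + 1 = d * (n + 1) := by rw [mul_add]; omega
    rw [hindex]
    exact (orderedCfDen_mul_add α (n + 1) ⟨0, NeZero.pos d⟩).symm

theorem InterlacedDenominators.powerGrowth_orderedCfDen (hα : InterlacedDenominators a α)
    (ha : 1 < a) :
    PowerGrowth a 4 (2 * ⌈(4 : ℝ) ^ (a + 2)⌉₊) (orderedCfDen α) := by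
  have hbounds (k : ℕ) := hα.2 (k / d + 1) (Nat.le_add_left 1 _) (Fin.ofNat d k)
  have hnext (k : ℕ) : nextCfDen α (k / d + 1) (Fin.ofNat d k) = orderedCfDen α (k + 1) := by
    rw [nextCfDen_succ, Fin.val_ofNat, Nat.div_add_mod]
  exact ⟨ha, by norm_num, fun k => one_le_cfDen (hα.1 _) _, fun k => hnext k ▸ (hbounds k).1,
    fun k => hnext k ▸ (hbounds k).2⟩

theorem InterlacedDenominators.exists_powerGrowth_cfDen (hα : InterlacedDenominators a α)
    (ha : 1 < a) (j : Fin d) :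
    ∃ D, PowerGrowth (a ^ d) (4 ^ d) D fun n => cfDen (α j) (n + 1) := by
  simpa only [orderedCfDen_mul_add] using
    (hα.powerGrowth_orderedCfDen ha).exists_subseq (NeZero.ne d) j

theorem one_add_aBar (d : ℕ) [NeZero d] (a : ℝ) : 1 + aBar d a = a ^ (d - 1) * (2 - a) := by
  have hpow : a ^ d = a ^ (d - 1) * a := by rw [← pow_succ, Nat.sub_add_cancel (NeZero.pos d)]
  rw [aBar, hpow]
  ring

theorem InterlacedDenominators.eventually_exists_le_bump (hα : InterlacedDenominators a α)
    (ha : 1 < a) {ε : ℝ} (hε : 0 < ε) (hεa : ε < aBar d a) {x : Fin d → UnitAddCircle}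
    (hx : ∀ j, x j ∈ cantorTypeSet (α j)) (B : ℝ) :
    ∀ᶠ m : ℤ in cofinite, ∃ j n,
      B ≤ bump (aBar d a) ε (α j) (n + 1) (x j + m • (α j : UnitAddCircle)) := by
  have hQ := hα.powerGrowth_orderedCfDen ha
  have hprod := one_add_aBar d a
  have ha2 : a ≤ 2 := by
    have hpos : 0 < a ^ (d - 1) * (2 - a) := by linarith
    linarith [pos_of_mul_pos_right hpos (by positivity)]
  have habs : Tendsto (fun m : ℤ => 4 * |(m : ℝ)|) cofinite atTop :=
    (tendsto_norm_cocompact_atTop.comp Int.tendsto_coe_cofinite).const_mul_atTop four_pos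
  filter_upwards [habs.eventually (hQ.eventually_exists_mul_le_sq ha2 (d - 1)
    (s := 1 + aBar d a - ε) (by linarith) (max 256 (32 * B)))] with m ⟨k, hle, hsq⟩
  rw [add_assoc, Nat.sub_add_cancel (NeZero.pos d)] at hle hsq
  have hk := hQ.pos k
  have hkd := hQ.pos (k + d)
  rw [mul_pow, sq_abs] at hsq
  have hsmall : 16 * (orderedCfDen α k * orderedCfDen α (k + d)) ≤ (m : ℝ) ^ 2 := by
    have hrpow : orderedCfDen α k ≤ orderedCfDen α k ^ (1 + aBar d a - ε) :=
      Real.self_le_rpow_of_one_le (hQ.one_le k) (by linarith)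
    have : 256 * (orderedCfDen α k * orderedCfDen α (k + d)) ≤ 4 ^ 2 * (m : ℝ) ^ 2 :=
      hsq.trans' (by gcongr; exact le_max_left _ _)
    linarith
  have hlarge : B ≤ (m : ℝ) ^ 2 /
      (2 * (orderedCfDen α k ^ (1 + aBar d a - ε) * orderedCfDen α (k + d))) := by
    have : 32 * B * (orderedCfDen α k ^ (1 + aBar d a - ε) * orderedCfDen α (k + d)) ≤
        4 ^ 2 * (m : ℝ) ^ 2 := hsq.trans' (by gcongr; exact le_max_right _ _)
    rw [le_div_iff₀ (by positivity)]
    linarith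
  rw [orderedCfDen_add_self] at hle hsmall hlarge
  exact ⟨Fin.ofNat d k, k / d, hlarge.trans <| le_bump_add_zsmul (hα.1 _) _ _ (hx _)
    (Nat.le_add_left 1 _) (by linarith [abs_nonneg (m : ℝ)]) hsmall⟩

theorem InterlacedDenominators.pi_cantorTypeSet_subset_discreteOrbitSet
    (hα : InterlacedDenominators a α) (ha : 1 < a) {ε : ℝ} (hε : 0 < ε) (hεa : ε < aBar d a) :
    Set.univ.pi (fun j => cantorTypeSet (α j)) ⊆
      discreteOrbitSet α (torusCocycle (aBar d a) ε α) := by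
  intro x hx
  rw [Set.mem_univ_pi] at hx
  have hdiv : Tendsto (fun m : ℤ => |cocycleSum (fun j => (α j : UnitAddCircle))
      (torusCocycle (aBar d a) ε α) m x|) cofinite atTop := by
    refine tendsto_atTop.2 fun B => ?_
    filter_upwards [hα.eventually_exists_le_bump ha hε hεa hx
      (B + ∑ j, ∑' n, bump (aBar d a) ε (α j) (n + 1) (x j))] with m ⟨j, n, hB⟩
    exact le_abs.2 (.inl (by linarith [bump_le_cocycleSum_torusCocycle_add hα.1 hεa hx m j n]))
  rw [Int.cofinite_eq, tendsto_sup] at hdiv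
  exact hdiv.symm

end Interlaced

/-! ### Mixed radix expansions -/

section MixedRadix

/-- The number of words of length `n` whose `i`-th digit is less than `N i`. -/
def radixProd (N : ℕ → ℕ) (n : ℕ) : ℕ := ∏ i ∈ Finset.range n, N i

/-- The digits of the expansion `t = ∑ n, radixDigit N t n / radixProd N (n + 1)` of
`t ∈ [0, 1)` in the mixed radix `N`. -/
def radixDigit (N : ℕ → ℕ) (t : ℝ) (n : ℕ) : ℕ := ⌊t * radixProd N (n + 1)⌋₊ % N n

variable {N : ℕ → ℕ} {t t' : ℝ}

theorem radixProd_succ (N : ℕ → ℕ) (n : ℕ) : radixProd N (n + 1) = radixProd N n * N n :=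
  Finset.prod_range_succ N n

theorem radixProd_pos (hN : ∀ n, 0 < N n) (n : ℕ) : 0 < radixProd N n :=
  Finset.prod_pos fun i _ => hN i

theorem two_pow_le_radixProd (hN : ∀ n, 2 ≤ N n) (n : ℕ) : 2 ^ n ≤ radixProd N n := by
  simpa [radixProd] using Finset.pow_card_le_prod (Finset.range n) N 2 fun i _ => hN i

theorem floor_mul_radixProd_succ_div {n : ℕ} (hN : 0 < N n) (t : ℝ) :
    ⌊t * radixProd N (n + 1)⌋₊ / N n = ⌊t * radixProd N n⌋₊ := by
  have hne : (N n : ℝ) ≠ 0 := by exact_mod_cast hN.ne'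
  rw [← Nat.floor_div_natCast, radixProd_succ, Nat.cast_mul, ← mul_assoc,
    mul_div_cancel_right₀ _ hne]

theorem exists_floor_mul_radixProd_ne (hN : ∀ n, 2 ≤ N n) (ht : 0 ≤ t) (htt' : t < t') :
    ∃ n, ⌊t * radixProd N n⌋₊ ≠ ⌊t' * radixProd N n⌋₊ := by
  obtain ⟨n, hn⟩ := pow_unbounded_of_one_lt (1 / (t' - t)) (one_lt_two (α := ℝ))
  refine ⟨n, fun heq => ?_⟩
  have hgap : 1 < (t' - t) * radixProd N n := by
    rw [div_lt_iff₀' (sub_pos.2 htt')] at hn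
    refine hn.trans_le (mul_le_mul_of_nonneg_left ?_ (sub_pos.2 htt').le)
    exact_mod_cast two_pow_le_radixProd hN n
  have hfloor := Nat.floor_le (a := t * radixProd N n) (by positivity)
  have hfloor' := Nat.lt_floor_add_one (t' * radixProd N n)
  rw [← heq] at hfloor'
  linarith

theorem exists_first_floor_mul_radixProd_ne (hN : ∀ n, 2 ≤ N n) (ht : 0 ≤ t) (htt' : t < t')
    (ht' : t' < 1) :
    ∃ m, (∀ i ≤ m, ⌊t * radixProd N i⌋₊ = ⌊t' * radixProd N i⌋₊) ∧
      ⌊t * radixProd N (m + 1)⌋₊ ≠ ⌊t' * radixProd N (m + 1)⌋₊ := by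
  classical
  have hex := exists_floor_mul_radixProd_ne hN ht htt'
  have hzero : Nat.find hex ≠ 0 := by
    rw [Ne, Nat.find_eq_zero, not_not, radixProd, Finset.range_zero, Finset.prod_empty,
      Nat.cast_one, mul_one, mul_one, Nat.floor_eq_zero.2 (htt'.trans ht'),
      Nat.floor_eq_zero.2 ht']
  obtain ⟨m, hm⟩ := Nat.exists_eq_succ_of_ne_zero hzero
  have hspec := Nat.find_spec hex
  rw [hm] at hspec
  exact ⟨m, fun i hi => not_not.1 (Nat.find_min hex (by omega)), hspec⟩

theorem exists_first_radixDigit_lt (hN : ∀ n, 2 ≤ N n) (ht : 0 ≤ t) (htt' : t < t')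
    (ht' : t' < 1) :
    ∃ m, (∀ i < m, radixDigit N t i = radixDigit N t' i) ∧
      radixDigit N t m < radixDigit N t' m ∧
      (t' - t) * radixProd N (m + 1) ≤
        2 * ((radixDigit N t' m : ℝ) - radixDigit N t m) := by
  obtain ⟨m, heq, hne⟩ := exists_first_floor_mul_radixProd_ne hN ht htt' ht'
  have hdiv (t : ℝ) : N m * ⌊t * radixProd N m⌋₊ + radixDigit N t m =
      ⌊t * radixProd N (m + 1)⌋₊ := by
    rw [← floor_mul_radixProd_succ_div (two_pos.trans_le (hN m))]
    exact Nat.div_add_mod _ _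
  have hlt : ⌊t * radixProd N (m + 1)⌋₊ < ⌊t' * radixProd N (m + 1)⌋₊ :=
    lt_of_le_of_ne (Nat.floor_mono (by gcongr)) hne
  have hdigit : radixDigit N t m < radixDigit N t' m := by
    have := heq m le_rfl ▸ hdiv t
    have := hdiv t'
    omega
  refine ⟨m, fun i hi => by rw [radixDigit, radixDigit, heq (i + 1) hi], hdigit, ?_⟩
  have hfloor := Nat.floor_le (a := t * radixProd N (m + 1)) (by positivity)
  have hfloor' := Nat.lt_floor_add_one (t' * radixProd N (m + 1))
  have hone : (radixDigit N t m : ℝ) + 1 ≤ radixDigit N t' m := by exact_mod_cast hdigit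
  rw [← hdiv t, heq m le_rfl] at hfloor
  rw [← hdiv t'] at hfloor'
  push_cast at hfloor hfloor'
  linarith

end MixedRadix

/-! ### Cantor schemes in the Cantor-type sets -/

section CantorScheme

/-- The number of intervals of level `n + 1` kept inside an interval of level `n`. Two of the
roughly `√(w (n + 1) / w n)` intervals that meet it are discarded, as they may stick out. -/
def childCount (w : ℕ → ℝ) (n : ℕ) : ℕ := ⌊√(w (n + 1) / w n)⌋₊ - 1

/-- The numerator `l` of the centre `l / w n` of the interval of level `n` with address
`u 0, …, u (n - 1)`, where `u i < childCount w i`. Only the right half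
`[l / w n, l / w n + cantorRadius w n]` of each interval is subdivided. -/
def cantorIndex (w : ℕ → ℝ) (u : ℕ → ℕ) : ℕ → ℕ
  | 0 => 0
  | n + 1 => ⌈w (n + 1) * (cantorIndex w u n / w n)⌉₊ + u n

/-- The radius of the intervals of level `n`. -/
def cantorRadius (w : ℕ → ℝ) (n : ℕ) : ℝ := 1 / √(w n * w (n + 1))

/-- The point of the Cantor scheme with address `u`, the limit of the left end points of the
half-intervals containing it. -/
def cantorPoint (w : ℕ → ℝ) (u : ℕ → ℕ) : ℝ := ⨆ n, (cantorIndex w u n : ℝ) / w n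

variable {w : ℕ → ℝ}

theorem cantorRadius_nonneg (w : ℕ → ℝ) (n : ℕ) : 0 ≤ cantorRadius w n := by
  unfold cantorRadius
  positivity

theorem cantorIndex_congr {u v : ℕ → ℕ} {m : ℕ} (huv : ∀ i < m, u i = v i) :
    cantorIndex w u m = cantorIndex w v m := by
  induction m with
  | zero => rfl
  | succ m ih =>
    rw [cantorIndex, cantorIndex, ih fun i hi => huv i (hi.trans m.lt_succ_self),
      huv m m.lt_succ_self]

variable (hw : ∀ n, 0 < w n)
include hw

theorem mul_cantorRadius (n : ℕ) : w (n + 1) * cantorRadius w n = √(w (n + 1) / w n) := by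
  have hn := hw n
  have hsq := Real.mul_self_sqrt (hw (n + 1)).le
  rw [cantorRadius, Real.sqrt_div (hw (n + 1)).le, Real.sqrt_mul hn.le]
  have hn' := hw (n + 1)
  field_simp
  linarith

theorem cantorIndex_div_monotone (u : ℕ → ℕ) :
    Monotone fun n => (cantorIndex w u n : ℝ) / w n := by
  refine monotone_nat_of_le_succ fun n => ?_
  rw [le_div_iff₀' (hw (n + 1)), cantorIndex, Nat.cast_add]
  exact (Nat.le_ceil _).trans (le_add_of_nonneg_right (Nat.cast_nonneg _))

variable (hg : ∀ n, 16 * w n ≤ w (n + 1))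
include hg

theorem four_le_sqrt_div (n : ℕ) : 4 ≤ √(w (n + 1) / w n) := by
  apply Real.le_sqrt_of_sq_le
  rw [le_div_iff₀ (hw n)]
  linarith [hg n]

theorem natCast_childCount (n : ℕ) :
    (childCount w n : ℝ) = ⌊√(w (n + 1) / w n)⌋₊ - 1 := by
  have hfloor : 4 ≤ ⌊√(w (n + 1) / w n)⌋₊ :=
    Nat.le_floor (by exact_mod_cast four_le_sqrt_div hw hg n)
  rw [childCount, Nat.cast_sub (by omega), Nat.cast_one]

theorem childCount_add_one_le (n : ℕ) : (childCount w n : ℝ) + 1 ≤ √(w (n + 1) / w n) := by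
  linarith [natCast_childCount hw hg n, Nat.floor_le (Real.sqrt_nonneg (w (n + 1) / w n))]

theorem sqrt_le_two_mul_childCount (n : ℕ) : √(w (n + 1) / w n) ≤ 2 * childCount w n := by
  linarith [natCast_childCount hw hg n, Nat.lt_floor_add_one (√(w (n + 1) / w n)),
    four_le_sqrt_div hw hg n]

theorem two_le_childCount (n : ℕ) : 2 ≤ childCount w n := by
  have : (2 : ℝ) ≤ childCount w n := by
    linarith [sqrt_le_two_mul_childCount hw hg n, four_le_sqrt_div hw hg n]
  exact_mod_cast this

theorem cantorRadius_le (n : ℕ) : cantorRadius w n ≤ 1 / (4 * w n) := by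
  have hn := hw n
  unfold cantorRadius
  gcongr
  apply Real.le_sqrt_of_sq_le
  nlinarith [hg n]

section Address

variable {u : ℕ → ℕ} (hu : ∀ n, u n < childCount w n)
include hu

theorem cantorIndex_div_add_cantorRadius_antitone :
    Antitone fun n => (cantorIndex w u n : ℝ) / w n + cantorRadius w n := by
  refine antitone_nat_of_succ_le fun n => ?_
  have hn := hw n
  have hn' := hw (n + 1)
  have hceil := Nat.ceil_lt_add_one
    (a := w (n + 1) * ((cantorIndex w u n : ℝ) / w n)) (by positivity)
  have hdigit : (u n : ℝ) + 1 ≤ childCount w n := by exact_mod_cast hu n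
  have hradius : w (n + 1) * cantorRadius w (n + 1) ≤ 1 :=
    calc _ ≤ w (n + 1) * (1 / (4 * w (n + 1))) := by gcongr; exact cantorRadius_le hw hg _
      _ ≤ 1 := by field_simp; norm_num
  refine le_of_mul_le_mul_left ?_ hn'
  rw [mul_add, mul_add, mul_div_cancel₀ _ hn'.ne', mul_cantorRadius hw, cantorIndex, Nat.cast_add]
  linarith [childCount_add_one_le hw hg n]

theorem cantorIndex_div_le (m n : ℕ) :
    (cantorIndex w u m : ℝ) / w m ≤ cantorIndex w u n / w n + cantorRadius w n := by
  rcases le_total m n with h | h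
  · exact (cantorIndex_div_monotone hw u h).trans
      (le_add_of_nonneg_right (cantorRadius_nonneg w n))
  · exact (le_add_of_nonneg_right (cantorRadius_nonneg w m)).trans
      (cantorIndex_div_add_cantorRadius_antitone hw hg hu h)

theorem cantorPoint_mem_Icc (n : ℕ) :
    cantorPoint w u ∈
      Set.Icc ((cantorIndex w u n : ℝ) / w n) (cantorIndex w u n / w n + cantorRadius w n) :=
  ⟨le_ciSup (f := fun n => (cantorIndex w u n : ℝ) / w n)
    ⟨_, Set.forall_mem_range.2 fun m => cantorIndex_div_le hw hg hu m 0⟩ n,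
    ciSup_le fun m => cantorIndex_div_le hw hg hu m n⟩

theorem cantorPoint_mem_Icc_zero_quarter (hw0 : 1 ≤ w 0) :
    cantorPoint w u ∈ Set.Icc (0 : ℝ) (1 / 4) := by
  obtain ⟨hle, hge⟩ := cantorPoint_mem_Icc hw hg hu 0
  simp only [cantorIndex, Nat.cast_zero, zero_div, zero_add] at hle hge
  refine ⟨hle, hge.trans ((cantorRadius_le hw hg 0).trans ?_)⟩
  gcongr
  linarith

theorem cantorIndex_lt (hw0 : 1 ≤ w 0) (n : ℕ) : (cantorIndex w u n : ℝ) < w n := by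
  rw [← div_lt_one (hw n)]
  linarith [(cantorPoint_mem_Icc hw hg hu n).1,
    (cantorPoint_mem_Icc_zero_quarter hw hg hu hw0).2]

theorem div_le_cantorPoint_sub {v : ℕ → ℕ} (hv : ∀ n, v n < childCount w n) {m : ℕ}
    (huv : ∀ i < m, u i = v i) (hlt : u m < v m) :
    ((v m : ℝ) - u m) / (2 * w (m + 1)) ≤ cantorPoint w v - cantorPoint w u := by
  have hpos := hw (m + 1)
  have hone : (1 : ℝ) ≤ v m - u m := by
    rw [le_sub_iff_add_le']
    exact_mod_cast hlt
  have hindex : (cantorIndex w v (m + 1) : ℝ) = cantorIndex w u (m + 1) + (v m - u m) := by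
    rw [cantorIndex, cantorIndex, cantorIndex_congr huv]
    push_cast
    ring
  have hright := (cantorPoint_mem_Icc hw hg hu (m + 1)).2
  have hleft := (cantorPoint_mem_Icc hw hg hv (m + 1)).1
  have hradius : cantorRadius w (m + 1) ≤ ((v m : ℝ) - u m) / (2 * w (m + 1)) :=
    (cantorRadius_le hw hg (m + 1)).trans (by gcongr; norm_num)
  have hhalf : ((v m : ℝ) - u m) / w (m + 1) = 2 * ((v m - u m) / (2 * w (m + 1))) := by
    field_simp
  rw [hindex, add_div] at hleft
  linarith

end Address

theorem sqrt_le_mul_radixProd_childCount (n : ℕ) :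
    √(w n) ≤ √(w 0) * (2 ^ n * radixProd (childCount w) n) := by
  induction n with
  | zero => simp [radixProd]
  | succ n ih =>
    have hn := hw n
    calc √(w (n + 1)) = √(w n) * √(w (n + 1) / w n) := by
          rw [← Real.sqrt_mul hn.le, mul_div_cancel₀ _ hn.ne']
      _ ≤ √(w 0) * (2 ^ n * radixProd (childCount w) n) * (2 * childCount w n) := by
          gcongr
          exact sqrt_le_two_mul_childCount hw hg n
      _ = √(w 0) * (2 ^ (n + 1) * radixProd (childCount w) (n + 1)) := by
          rw [radixProd_succ]
          push_cast
          ring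

theorem sq_two_mul_div_childCount_le (n : ℕ) :
    (2 * w (n + 1) / childCount w n) ^ 2 ≤ 16 * (w n * w (n + 1)) := by
  have hn := hw n
  have hn' := hw (n + 1)
  have hN : (0 : ℝ) < childCount w n := by
    exact_mod_cast two_pos.trans_le (two_le_childCount hw hg n)
  have hratio : w (n + 1) / w n ≤ (2 * childCount w n) ^ 2 :=
    (Real.sqrt_le_left (by positivity)).1 (sqrt_le_two_mul_childCount hw hg n)
  rw [div_le_iff₀ hn] at hratio
  rw [div_pow, div_le_iff₀ (by positivity)]
  calc (2 * w (n + 1)) ^ 2 = 4 * w (n + 1) * w (n + 1) := by ring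
    _ ≤ 4 * w (n + 1) * ((2 * childCount w n) ^ 2 * w n) := by gcongr
    _ = 16 * (w n * w (n + 1)) * childCount w n ^ 2 := by ring

end CantorScheme

/-! ### Hölder estimate for addresses -/

namespace PowerGrowth

variable {b c D : ℝ} {w : ℕ → ℝ} (hQ : PowerGrowth b c D w)
include hQ

theorem rpow_le (n : ℕ) : w n ^ b ≤ w (n + 1) :=
  (le_mul_of_one_le_left (Real.rpow_nonneg (hQ.pos n).le b) hQ.one_lt_const.le).trans
    (hQ.mul_rpow_le n)

theorem exists_two_pow_le_mul_rpow {η : ℝ} (hη : 0 < η) :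
    ∃ K : ℝ, 0 < K ∧ ∀ n, 2 ^ n ≤ K * w n ^ η := by
  have hb := sub_pos.2 hQ.one_lt_exponent
  obtain ⟨m, hm⟩ := (hQ.eventually_le_rpow (mul_pos hb hη) 2).exists_forall_of_atTop
  have hrpow (n : ℕ) : 1 ≤ w n ^ η := Real.one_le_rpow (hQ.one_le n) hη.le
  refine ⟨2 ^ m, by positivity, fun n => ?_⟩
  rcases le_total n m with hn | hn
  · exact (pow_le_pow_right₀ one_le_two hn).trans
      (le_mul_of_one_le_right (by positivity) (hrpow n))
  induction n, hn using Nat.le_induction with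
  | base => exact le_mul_of_one_le_right (by positivity) (hrpow m)
  | succ n hn ih =>
    have hpos := hQ.pos n
    calc (2 : ℝ) ^ (n + 1) = 2 * 2 ^ n := pow_succ' 2 n
      _ ≤ w n ^ ((b - 1) * η) * (2 ^ m * w n ^ η) := by gcongr; exact hm n hn
      _ = 2 ^ m * (w n ^ b) ^ η := by
          rw [mul_left_comm, ← Real.rpow_add hpos, ← Real.rpow_mul hpos.le]
          ring_nf
      _ ≤ 2 ^ m * w (n + 1) ^ η := by gcongr; exact hQ.rpow_le n

variable (hc : 16 ≤ c)
include hc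

theorem sixteen_mul_le (n : ℕ) : 16 * w n ≤ w (n + 1) :=
  (mul_le_mul_of_nonneg_right hc (hQ.pos n).le).trans (hQ.mul_le n)

theorem exists_rpow_le_mul_radixProd_childCount {θ : ℝ} (hθ : θ < 1 / 2) :
    ∃ K : ℝ, 0 < K ∧ ∀ n, w n ^ θ ≤ K * radixProd (childCount w) n := by
  obtain ⟨K, hK, htwo⟩ := hQ.exists_two_pow_le_mul_rpow (sub_pos.2 hθ)
  have hzero := hQ.pos 0
  refine ⟨√(w 0) * K, by positivity, fun n => ?_⟩
  have hn := hQ.pos n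
  refine le_of_mul_le_mul_right ?_ (Real.rpow_pos_of_pos hn (1 / 2 - θ))
  calc w n ^ θ * w n ^ (1 / 2 - θ) = √(w n) := by
        rw [← Real.rpow_add hn, add_sub_cancel, Real.sqrt_eq_rpow]
    _ ≤ √(w 0) * (2 ^ n * radixProd (childCount w) n) :=
        sqrt_le_mul_radixProd_childCount hQ.pos (hQ.sixteen_mul_le hc) n
    _ ≤ √(w 0) * (K * w n ^ (1 / 2 - θ) * radixProd (childCount w) n) := by
        gcongr
        exact htwo n
    _ = √(w 0) * K * radixProd (childCount w) n * w n ^ (1 / 2 - θ) := by ring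

theorem two_mul_div_childCount_rpow_le {s : ℝ} (hs : 0 < s) (n : ℕ) :
    (2 * w (n + 1) / childCount w n) ^ s ≤ (16 * D) ^ (s / 2) * w n ^ (s * (1 + b) / 2) := by
  have hn := hQ.pos n
  have hn' := hQ.pos (n + 1)
  have hD := hQ.const_pos
  have hsq : (2 * w (n + 1) / childCount w n) ^ 2 ≤ 16 * D * w n ^ (1 + b) :=
    calc _ ≤ 16 * (w n * w (n + 1)) :=
          sq_two_mul_div_childCount_le hQ.pos (hQ.sixteen_mul_le hc) n
      _ ≤ 16 * (w n * (D * w n ^ b)) := by gcongr; exact hQ.le_mul_rpow n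
      _ = 16 * D * w n ^ (1 + b) := by rw [Real.rpow_add hn, Real.rpow_one]; ring
  calc (2 * w (n + 1) / childCount w n) ^ s
      = ((2 * w (n + 1) / childCount w n) ^ 2) ^ (s / 2) := by
        rw [← Real.rpow_two, ← Real.rpow_mul (by positivity), mul_div_cancel₀ s two_ne_zero]
    _ ≤ (16 * D * w n ^ (1 + b)) ^ (s / 2) := by gcongr
    _ = (16 * D) ^ (s / 2) * w n ^ (s * (1 + b) / 2) := by
        rw [Real.mul_rpow (by positivity) (by positivity), ← Real.rpow_mul hn.le]
        ring_nf

theorem exists_div_radixProd_childCount_le {s : ℝ} (hs : 0 < s) (hsb : s * (1 + b) < 1) :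
    ∃ K : ℝ, 0 < K ∧ ∀ n (x : ℝ), 0 ≤ x → x ≤ childCount w n →
      2 * x / radixProd (childCount w) (n + 1) ≤ K * (x / (2 * w (n + 1))) ^ s := by
  obtain ⟨K, hK, hle⟩ := hQ.exists_rpow_le_mul_radixProd_childCount hc
    (θ := s * (1 + b) / 2) (by linarith)
  have hD := hQ.const_pos
  have hs1 : s ≤ 1 := by nlinarith [hQ.one_lt_exponent]
  refine ⟨2 * (16 * D) ^ (s / 2) * K, by positivity, fun n x hx hxN => ?_⟩
  have hn := hQ.pos (n + 1)
  have htwo := two_le_childCount hQ.pos (hQ.sixteen_mul_le hc)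
  have hN : (0 : ℝ) < childCount w n := by exact_mod_cast two_pos.trans_le (htwo n)
  have hP : (0 : ℝ) < radixProd (childCount w) n := by
    exact_mod_cast radixProd_pos (fun n => two_pos.trans_le (htwo n)) n
  have hdigit : x / childCount w n ≤
      (x / (2 * w (n + 1))) ^ s * ((16 * D) ^ (s / 2) * (K * radixProd (childCount w) n)) :=
    calc x / childCount w n ≤ (x / childCount w n) ^ s :=
          Real.self_le_rpow_of_le_one (by positivity) ((div_le_one hN).2 hxN) hs1
      _ = (x / (2 * w (n + 1))) ^ s * (2 * w (n + 1) / childCount w n) ^ s := by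
          rw [← Real.mul_rpow (by positivity) (by positivity), div_mul_div_cancel₀ (by positivity)]
      _ ≤ _ := by
          gcongr
          refine (hQ.two_mul_div_childCount_rpow_le hc hs n).trans ?_
          gcongr
          exact hle n
  rw [radixProd_succ, Nat.cast_mul]
  calc 2 * x / (radixProd (childCount w) n * childCount w n)
      = 2 / radixProd (childCount w) n * (x / childCount w n) := mul_div_mul_comm 2 x _ _
    _ ≤ 2 / radixProd (childCount w) n * ((x / (2 * w (n + 1))) ^ s *
          ((16 * D) ^ (s / 2) * (K * radixProd (childCount w) n))) := by gcongr
    _ = 2 * (16 * D) ^ (s / 2) * K * (x / (2 * w (n + 1))) ^ s := by field_simp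

theorem radixDigit_childCount_lt (t : ℝ) (n : ℕ) :
    radixDigit (childCount w) t n < childCount w n :=
  Nat.mod_lt _ (two_pos.trans_le (two_le_childCount hQ.pos (hQ.sixteen_mul_le hc) n))

theorem exists_abs_sub_le_mul_abs_cantorPoint_sub_rpow {s : ℝ} (hs : 0 < s)
    (hsb : s * (1 + b) < 1) :
    ∃ K : ℝ, 0 < K ∧ ∀ t ∈ Set.Ico (0 : ℝ) 1, ∀ t' ∈ Set.Ico (0 : ℝ) 1,
      |t - t'| ≤ K * |cantorPoint w (radixDigit (childCount w) t) -
        cantorPoint w (radixDigit (childCount w) t')| ^ s := by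
  obtain ⟨K, hK, hle⟩ := hQ.exists_div_radixProd_childCount_le hc hs hsb
  have hg := hQ.sixteen_mul_le hc
  have hdigit := hQ.radixDigit_childCount_lt hc
  refine ⟨K, hK, fun t ht t' ht' => ?_⟩
  wlog hlt : t < t' generalizing t t'
  · rcases (not_lt.1 hlt).eq_or_lt with rfl | hgt
    · rw [sub_self, abs_zero]
      positivity
    · rw [abs_sub_comm t, abs_sub_comm (cantorPoint w _)]
      exact this t' ht' t ht hgt
  have htwo := two_le_childCount hQ.pos hg
  obtain ⟨m, heq, hdigit_lt, hsep⟩ := exists_first_radixDigit_lt htwo ht.1 hlt ht'.2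
  have hP : (0 : ℝ) < radixProd (childCount w) (m + 1) := by
    exact_mod_cast radixProd_pos (fun n => two_pos.trans_le (htwo n)) (m + 1)
  have hdiff : (0 : ℝ) ≤ radixDigit (childCount w) t' m - radixDigit (childCount w) t m :=
    sub_nonneg.2 (by exact_mod_cast hdigit_lt.le)
  have hdigit_le : (radixDigit (childCount w) t' m : ℝ) - radixDigit (childCount w) t m ≤
      childCount w m :=
    (sub_le_self _ (Nat.cast_nonneg _)).trans (by exact_mod_cast (hdigit t' m).le)
  have hpos := hQ.pos (m + 1)
  rw [abs_sub_comm, abs_of_pos (sub_pos.2 hlt)]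
  refine (((le_div_iff₀ hP).2 hsep).trans (hle m _ hdiff hdigit_le)).trans ?_
  gcongr
  rw [abs_sub_comm]
  exact (div_le_cantorPoint_sub hQ.pos hg (hdigit t) (hdigit t') heq hdigit_lt).trans
    (le_abs_self _)

end PowerGrowth

/-! ### Hausdorff dimension -/

section Dimension

/-- The map `g` does not contract distances on `S` by more than the power `1 / s`: the lower
Hölder bound that relates to `HolderOnWith` as `AntilipschitzWith` does to `LipschitzWith`. -/
def AntiholderOnWith {X Y : Type*} [PseudoEMetricSpace X] [PseudoEMetricSpace Y] (K s : ℝ≥0)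
    (g : Y → X) (S : Set Y) : Prop :=
  ∀ y ∈ S, ∀ y' ∈ S, edist y y' ≤ K * edist (g y) (g y') ^ (s : ℝ)

theorem AntiholderOnWith.injOn {X Y : Type*} [PseudoEMetricSpace X] [EMetricSpace Y] {K s : ℝ≥0}
    {g : Y → X} {S : Set Y} (hg : AntiholderOnWith K s g S) (hs : 0 < s) : Set.InjOn g S := by
  intro y hy y' hy' heq
  have hdist := hg y hy y' hy'
  rw [heq, edist_self, ENNReal.zero_rpow_of_pos (by exact_mod_cast hs), mul_zero] at hdist
  exact edist_le_zero.1 hdist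

theorem AntiholderOnWith.mul_dimH_le {X Y : Type*} [EMetricSpace X] [EMetricSpace Y] {K s : ℝ≥0}
    {g : Y → X} {S : Set Y} (hg : AntiholderOnWith K s g S) (hs : 0 < s) :
    s * dimH S ≤ dimH (g '' S) := by
  rcases isEmpty_or_nonempty Y with hY | hY
  · simp [S.eq_empty_of_isEmpty]
  have hinv : Set.LeftInvOn (Function.invFunOn g S) g S := (hg.injOn hs).leftInvOn_invFunOn
  have hholder : HolderOnWith K s (Function.invFunOn g S) (g '' S) := by
    rintro _ ⟨y, hy, rfl⟩ _ ⟨y', hy', rfl⟩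
    rw [hinv hy, hinv hy']
    exact hg y hy y' hy'
  have hdim := hholder.dimH_image_le hs
  rw [hinv.image_image] at hdim
  exact mul_comm (s : ℝ≥0∞) _ ▸ ENNReal.mul_le_of_le_div hdim

theorem AntiholderOnWith.pi {ι : Type*} [Fintype ι] {X Y : ι → Type*}
    [∀ i, PseudoEMetricSpace (X i)] [∀ i, PseudoEMetricSpace (Y i)] {K : ι → ℝ≥0} {s : ℝ≥0}
    {g : ∀ i, Y i → X i} {S : ∀ i, Set (Y i)} (hg : ∀ i, AntiholderOnWith (K i) s (g i) (S i)) :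
    AntiholderOnWith (∑ i, K i) s (fun y i => g i (y i)) (Set.univ.pi S) := by
  intro y hy y' hy'
  rw [Set.mem_univ_pi] at hy hy'
  refine edist_pi_le_iff.2 fun i => (hg i _ (hy i) _ (hy' i)).trans ?_
  gcongr
  · exact Finset.single_le_sum (fun _ _ => zero_le) (Finset.mem_univ i)
  · exact edist_le_pi_edist (fun i => g i (y i)) (fun i => g i (y' i)) i

theorem AntiholderOnWith.le_dimH {X : Type*} [EMetricSpace X] {K s : ℝ≥0} {g : ℝ → X}
    {F : Set X} (hg : AntiholderOnWith K s g (Set.Ico 0 1)) (hs : 0 < s)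
    (hF : Set.MapsTo g (Set.Ico 0 1) F) : (s : ℝ≥0∞) ≤ dimH F := by
  have hIco : dimH (Set.Ico (0 : ℝ) 1) = 1 := by
    rw [Real.dimH_of_nonempty_interior (by simp), Module.finrank_self, Nat.cast_one]
  have hdim := hg.mul_dimH_le hs
  rw [hIco, mul_one] at hdim
  exact hdim.trans (dimH_mono hF.image_subset)

theorem AntiholderOnWith.mul_card_le_dimH_pi {ι : Type*} [Fintype ι] {X : ι → Type*}
    [∀ i, EMetricSpace (X i)] {K : ι → ℝ≥0} {s : ℝ≥0} {g : ∀ i, ℝ → X i} {F : ∀ i, Set (X i)}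
    (hg : ∀ i, AntiholderOnWith (K i) s (g i) (Set.Ico 0 1)) (hs : 0 < s)
    (hF : ∀ i, Set.MapsTo (g i) (Set.Ico 0 1) (F i)) :
    s * (Fintype.card ι : ℝ≥0∞) ≤ dimH (Set.univ.pi F) := by
  have hcube : dimH (Set.univ.pi fun _ : ι => Set.Ico (0 : ℝ) 1) = Fintype.card ι := by
    rw [Real.dimH_of_nonempty_interior, Module.finrank_fintype_fun_eq_card]
    rw [interior_pi_set Set.finite_univ, Set.univ_pi_nonempty_iff]
    exact fun _ => interior_Ico (α := ℝ) ▸ Set.nonempty_Ioo.2 one_pos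
  have hdim := (AntiholderOnWith.pi hg).mul_dimH_le hs
  rw [hcube] at hdim
  exact hdim.trans (dimH_mono (Set.MapsTo.image_subset fun y hy i _ => hF i (hy i trivial)))

theorem ofReal_mul_natCast_le_of_forall_lt {c : ℝ} (hc : 0 < c) (n : ℕ) {L : ℝ≥0∞}
    (h : ∀ s : ℝ≥0, 0 < s → s < c → s * (n : ℝ≥0∞) ≤ L) : ENNReal.ofReal (c * n) ≤ L := by
  have hlim : Tendsto (fun s : ℝ => ENNReal.ofReal (s * n)) (𝓝[<] c)
      (𝓝 (ENNReal.ofReal (c * n))) :=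
    ((ENNReal.continuous_ofReal.comp (continuous_mul_const (n : ℝ))).tendsto c).mono_left
      nhdsWithin_le_nhds
  refine le_of_tendsto hlim ?_
  filter_upwards [Ioo_mem_nhdsLT hc] with s hs
  rw [ENNReal.ofReal_mul hs.1.le, ENNReal.ofReal_natCast, ENNReal.ofReal_eq_coe_nnreal hs.1.le]
  exact h ⟨s, hs.1.le⟩ hs.1 hs.2

theorem coe_cantorPoint_mem_cantorTypeSet {α : ℝ} (hα : Irrational α)
    (hg : ∀ n, 16 * cfDen α (n + 1) ≤ cfDen α (n + 2)) {u : ℕ → ℕ}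
    (hu : ∀ n, u n < childCount (fun n => cfDen α (n + 1)) n) :
    (cantorPoint (fun n => cfDen α (n + 1)) u : UnitAddCircle) ∈ cantorTypeSet α := by
  have hw (n : ℕ) := cfDen_pos hα (n + 1)
  simp only [cantorTypeSet, Set.mem_iInter, Set.mem_iUnion]
  intro n hn
  obtain ⟨n, rfl⟩ := Nat.exists_eq_add_of_le' hn
  have hmem := cantorPoint_mem_Icc hw hg hu n
  exact ⟨cantorIndex _ u n, cantorIndex_lt hw hg hu (one_le_cfDen hα 1) n, _,
    ⟨(sub_le_self _ (by positivity)).trans hmem.1, hmem.2⟩, rfl⟩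

theorem edist_coe_unitAddCircle {x y : ℝ} (hxy : |x - y| ≤ 1 / 2) :
    edist (x : UnitAddCircle) y = edist x y := by
  rw [edist_dist, edist_dist, dist_eq_norm, ← AddCircle.coe_sub,
    (AddCircle.norm_coe_eq_abs_iff _ one_ne_zero).2 (by rwa [abs_one]), Real.dist_eq]

theorem PowerGrowth.exists_antiholderOnWith_cantorTypeSet {α b c D : ℝ} (hα : Irrational α)
    (hQ : PowerGrowth b c D fun n => cfDen α (n + 1)) (hc : 16 ≤ c) {s : ℝ≥0} (hs : 0 < s)
    (hsb : s * (1 + b) < 1) :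
    ∃ (g : ℝ → UnitAddCircle) (K : ℝ≥0),
      AntiholderOnWith K s g (Set.Ico 0 1) ∧ Set.MapsTo g (Set.Ico 0 1) (cantorTypeSet α) := by
  obtain ⟨K, hK, hle⟩ := hQ.exists_abs_sub_le_mul_abs_cantorPoint_sub_rpow hc
    (NNReal.coe_pos.2 hs) hsb
  have hdigit := hQ.radixDigit_childCount_lt hc
  set N := childCount fun n => cfDen α (n + 1)
  set x : ℝ → ℝ := fun t => cantorPoint (fun n => cfDen α (n + 1)) (radixDigit N t)
  have hg := hQ.sixteen_mul_le hc
  have hx (t : ℝ) : x t ∈ Set.Icc (0 : ℝ) (1 / 4) :=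
    cantorPoint_mem_Icc_zero_quarter hQ.pos hg (hdigit t) (hQ.one_le 0)
  refine ⟨fun t => x t, K.toNNReal, fun t ht t' ht' => ?_,
    fun t _ => coe_cantorPoint_mem_cantorTypeSet hα hg (hdigit t)⟩
  have hnear : |x t - x t'| ≤ 1 / 2 := by
    rw [abs_le]
    constructor <;> linarith [(hx t).1, (hx t).2, (hx t').1, (hx t').2]
  rw [edist_coe_unitAddCircle hnear, edist_dist, edist_dist, Real.dist_eq, Real.dist_eq,
    ENNReal.ofReal_rpow_of_nonneg (abs_nonneg _) s.coe_nonneg, ← ENNReal.ofReal_coe_nnreal,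
    Real.coe_toNNReal _ hK.le, ← ENNReal.ofReal_mul hK.le]
  exact ENNReal.ofReal_le_ofReal (hle t ht t' ht')

namespace InterlacedDenominators

variable {d : ℕ} {a : ℝ} {α : Fin d → ℝ}

theorem exists_antiholderOnWith_cantorTypeSet (hα : InterlacedDenominators a α) (hd : 2 ≤ d)
    (ha : 1 < a) {s : ℝ≥0} (hs : 0 < s) (hsa : s < 1 / (1 + a ^ d)) (j : Fin d) :
    ∃ (g : ℝ → UnitAddCircle) (K : ℝ≥0), AntiholderOnWith K s g (Set.Ico 0 1) ∧
      Set.MapsTo g (Set.Ico 0 1) (cantorTypeSet (α j)) := by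
  have : NeZero d := ⟨by omega⟩
  obtain ⟨D, hD⟩ := hα.exists_powerGrowth_cfDen ha j
  have hc : (16 : ℝ) ≤ 4 ^ d :=
    calc (16 : ℝ) = 4 ^ 2 := by norm_num
      _ ≤ 4 ^ d := pow_le_pow_right₀ (by norm_num) hd
  exact hD.exists_antiholderOnWith_cantorTypeSet (hα.1 j) hc hs
    ((lt_div_iff₀ (by positivity)).1 hsa)

theorem ofReal_le_dimH_cantorTypeSet (hα : InterlacedDenominators a α) (hd : 2 ≤ d)
    (ha : 1 < a) (j : Fin d) : ENNReal.ofReal (1 / (1 + a ^ d)) ≤ dimH (cantorTypeSet (α j)) := by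
  suffices h : ENNReal.ofReal (1 / (1 + a ^ d) * (1 : ℕ)) ≤ dimH (cantorTypeSet (α j)) by
    rwa [Nat.cast_one, mul_one] at h
  refine ofReal_mul_natCast_le_of_forall_lt (by positivity) 1 fun s hs hsa => ?_
  obtain ⟨g, K, hg, hF⟩ := hα.exists_antiholderOnWith_cantorTypeSet hd ha hs hsa j
  rw [Nat.cast_one, mul_one]
  exact hg.le_dimH hs hF

theorem ofReal_le_dimH_pi_cantorTypeSet (hα : InterlacedDenominators a α) (hd : 2 ≤ d)
    (ha : 1 < a) :
    ENNReal.ofReal (d / (1 + a ^ d)) ≤ dimH (Set.univ.pi fun j => cantorTypeSet (α j)) := by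
  rw [← one_div_mul_eq_div]
  refine ofReal_mul_natCast_le_of_forall_lt (by positivity) d fun s hs hsa => ?_
  choose g K hg hF using hα.exists_antiholderOnWith_cantorTypeSet hd ha hs hsa
  simpa only [Fintype.card_fin] using AntiholderOnWith.mul_card_le_dimH_pi hg hs hF

end InterlacedDenominators

end Dimension

end

theorem mainTheorem6 (d : ℕ) (hd : 3 ≤ d) (a : ℝ) (ha : 1 < a) (hbar : 0 < aBar d a)
    (ε : ℝ) (hε : 0 < ε) (hεa : ε < aBar d a)
    (α : Fin d → ℝ) (hα : InterlacedDenominators a α) :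
    (∀ j : Fin d, ENNReal.ofReal (1 / (1 + a ^ d)) ≤ dimH (cantorTypeSet (α j))) ∧
    Set.univ.pi (fun j : Fin d => cantorTypeSet (α j)) ⊆
      discreteOrbitSet α (torusCocycle (aBar d a) ε α) ∧
    ENNReal.ofReal (d / (1 + a ^ d)) ≤
      dimH (Set.univ.pi (fun j : Fin d => cantorTypeSet (α j))) ∧
    0 < (d : ℝ) / (1 + a ^ d) := by
  have hdpos : 0 < d := by omega
  have : NeZero d := ⟨hdpos.ne'⟩
  have hd2 : 2 ≤ d := by omega
  exact ⟨hα.ofReal_le_dimH_cantorTypeSet hd2 ha,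
    hα.pi_cantorTypeSet_subset_discreteOrbitSet ha hε hεa,
    hα.ofReal_le_dimH_pi_cantorTypeSet hd2 ha, by positivity⟩
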